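/- **Definitions.** Let $h:(0,1)\to\mathbb R$ be the homeomorphism $h(x)=\log x-\log\tfrac12$ for $x\in(0,\tfrac12]$ and $h(x)=\log\tfrac12-\log(1-x)$ for $x\in[\tfrac12,1)$. Let $\mathrm C(\mathrm I)$ be the set of continuous maps $f$ of $[0,1]$ onto itself such that $f(0)=0$, $f(1)=1$, $f((0,1))\subset(0,1)$, and the one-sided derivatives $f'(0)$, $f'(1)$ exist and lie in $(0,\infty)$; equip it with the (finite) metric $d_{\mathrm C(\mathrm I)}(f,g)=\sup_{x\in(0,1)}|h(f(x))-h(g(x))|$. Let $\mathrm{RDS}(\mathrm I)$ be the set of triples $f=(f_0,f_1,p_f)\in \mathrm C(\mathrm I)\times \mathrm C(\mathrm I)\times[0,1]$ such that $f_0,f_1$ are homeomorphisms, $f_0(x)<x<f_1(x)$ for all $x\in(0,1)$, $p_f\in(0,1)$, and $p_f\log f_0'(j)+(1-p_f)\log f_1'(j)>0$ for $j\in\{0,1\}$; equip it with the metric $$d_m(f,g)=\max\{d_{\mathrm C(\mathrm I)}(f_0,g_0),\,d_{\mathrm C(\mathrm I)}(f_1,g_1),\,|p_f-p_g|\}.$$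 A Borel probability measure $\mu$ on $(0,1)$ is stationary for $f$ if $\mu(A)=p_f\,\mu(f_0^{-1}(A))+(1-p_f)\,\mu(f_1^{-1}(A))$ for every Borel set $A\subset(0,1)$. **Theorem.** Every $f\in\mathrm{RDS}(\mathrm I)$ has exactly one stationary Borel probability measure $\mu_f$ on $(0,1)$, and the map $\psi:f\mapsto\mu_f$ is continuous from $(\mathrm{RDS}(\mathrm I),d_m)$ to the space of Borel probability measures on $(0,1)$ with the weak$^*$ topology (the topology of convergence of integrals of bounded continuous functions on $(0,1)$). -/

import Mathlib

open Set MeasureTheory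

noncomputable section

namespace RandomInterval

/-- The open unit interval `(0,1)`, as a space. -/
abbrev OpenUnit : Type := Ioo (0 : ℝ) 1

/-- The inclusion of `(0,1)` into `[0,1]`. -/
def OpenUnit.incl (x : OpenUnit) : unitInterval := ⟨x.1, Ioo_subset_Icc_self x.2⟩

/-- The homeomorphism `h : (0,1) → ℝ` (the formula is only used on `(0,1)`). -/
def h (x : ℝ) : ℝ :=
  if x ≤ 1 / 2 then Real.log x - Real.log (1 / 2) else Real.log (1 / 2) - Real.log (1 - x)

/-- The metric `d_h` on `(0,1)`, given by `d_h(x,y) = |h(x) - h(y)|`. -/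
def dh (x y : ℝ) : ℝ := |h x - h y|

/-- A self-map of `[0,1]`, viewed as a real function which agrees with it on `[0,1]`. Only its
values on `[0,1]` matter for the one-sided derivatives below. -/
def ext (f : unitInterval → unitInterval) (x : ℝ) : ℝ := (f (projIcc 0 1 zero_le_one x) : ℝ)

/-- The set `C(I)`: continuous maps of `[0,1]` onto itself which fix the endpoints, map `(0,1)`
into `(0,1)`, and have (one-sided) derivatives in `(0,∞)` at both endpoints. -/
structure CI where
  /-- the underlying map -/
  toFun : unitInterval → unitInterval
  continuous_toFun : Continuous toFun
  surjective_toFun : Function.Surjective toFun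
  map_zero : toFun 0 = 0
  map_one : toFun 1 = 1
  map_open : ∀ x : OpenUnit, (toFun x.incl : ℝ) ∈ Ioo (0 : ℝ) 1
  differentiable_zero : DifferentiableWithinAt ℝ (ext toFun) (Icc 0 1) 0
  differentiable_one : DifferentiableWithinAt ℝ (ext toFun) (Icc 0 1) 1
  deriv_zero_pos : 0 < derivWithin (ext toFun) (Icc 0 1) 0
  deriv_one_pos : 0 < derivWithin (ext toFun) (Icc 0 1) 1

namespace CI

/-- The derivative `f'(0)`. -/
def derivZero (f : CI) : ℝ := derivWithin (ext f.toFun) (Icc 0 1) 0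

/-- The derivative `f'(1)`. -/
def derivOne (f : CI) : ℝ := derivWithin (ext f.toFun) (Icc 0 1) 1

/-- The restriction of `f ∈ C(I)` to a self-map of `(0,1)`. -/
def restr (f : CI) (x : OpenUnit) : OpenUnit := ⟨f.toFun x.incl, f.map_open x⟩

theorem continuous_restr (f : CI) : Continuous f.restr := by
  refine Continuous.subtype_mk ?_ _
  refine continuous_subtype_val.comp (f.continuous_toFun.comp ?_)
  exact Continuous.subtype_mk continuous_subtype_val _

end CI

theorem abs_h_sub_logit_le {x : ℝ} (hx : x ∈ Ioo (0 : ℝ) 1) :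
    |h x - (Real.log x - Real.log (1 - x))| ≤ Real.log 2 := by
  have hx0 := hx.1
  have hx1 := hx.2
  have hhalf : Real.log (1 / 2) = -Real.log 2 := by rw [one_div, Real.log_inv]
  unfold h
  split_ifs with hc
  · have h1 : Real.log (1 - x) ≤ 0 := Real.log_nonpos (by linarith) (by linarith)
    have h2 : Real.log (1 / 2) ≤ Real.log (1 - x) := Real.log_le_log (by norm_num) (by linarith)
    rw [abs_le]
    constructor <;> linarith [Real.log_pos (by norm_num : (1 : ℝ) < 2)]
  · have h1 : Real.log x ≤ 0 := Real.log_nonpos (by linarith) (by linarith)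
    have h2 : Real.log (1 / 2) ≤ Real.log x := Real.log_le_log (by norm_num) (by linarith)
    rw [abs_le]
    constructor <;> linarith [Real.log_pos (by norm_num : (1 : ℝ) < 2)]

theorem h_injOn : InjOn h (Ioo (0 : ℝ) 1) := by
  intro x hx y hy hxy
  have key : ∀ z : ℝ, z ∈ Ioo (0 : ℝ) 1 → ¬ z ≤ 1 / 2 → Real.log (1 - z) < Real.log (1 / 2) :=
    fun z hz hc => Real.log_lt_log (by linarith [hz.2]) (by linarith)
  have key2 : ∀ z : ℝ, z ∈ Ioo (0 : ℝ) 1 → z ≤ 1 / 2 → Real.log z ≤ Real.log (1 / 2) :=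
    fun z hz hc => Real.log_le_log hz.1 hc
  unfold h at hxy
  split_ifs at hxy with h1 h2 h2
  · exact Real.log_injOn_pos hx.1 hy.1 (by linarith)
  · linarith [key y hy h2, key2 x hx h1]
  · linarith [key x hx h1, key2 y hy h2]
  · have := Real.log_injOn_pos (show 1 - x ∈ Ioi (0 : ℝ) from by simpa using hx.2)
      (show 1 - y ∈ Ioi (0 : ℝ) from by simpa using hy.2) (by linarith)
    linarith

theorem exists_abs_log_slope_le {F : ℝ → ℝ} {c a : ℝ} (hc : c ∈ Icc (0 : ℝ) 1)
    (hF : ContinuousOn F (Icc 0 1)) (hd : HasDerivWithinAt F a (Icc 0 1) c) (ha : 0 < a)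
    (hpos : ∀ x ∈ Icc (0 : ℝ) 1, x ≠ c → 0 < slope F c x) :
    ∃ C : ℝ, ∀ x ∈ Icc (0 : ℝ) 1, x ≠ c → |Real.log (slope F c x)| ≤ C := by
  have hcont : ContinuousOn (Function.update (slope F c) c a) (Icc 0 1) := by
    intro x hx
    by_cases hxc : x = c
    · subst hxc
      rw [continuousWithinAt_update_same]
      exact hasDerivWithinAt_iff_tendsto_slope.1 hd
    · rw [continuousWithinAt_update_of_ne hxc]
      have h1 : ContinuousWithinAt (fun y => (y - c)⁻¹ * (F y - F c)) (Icc 0 1) x :=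
        ((continuousWithinAt_id.sub continuousWithinAt_const).inv₀ (sub_ne_zero.2 hxc)).mul
          ((hF x hx).sub continuousWithinAt_const)
      exact h1
  have hlog : ContinuousOn (fun x => Real.log (Function.update (slope F c) c a x)) (Icc 0 1) := by
    refine hcont.log fun x hx => ?_
    by_cases hxc : x = c
    · subst hxc; simpa using ha.ne'
    · rw [Function.update_of_ne hxc]; exact (hpos x hx hxc).ne'
  obtain ⟨C, hC⟩ := isCompact_Icc.exists_bound_of_continuousOn hlog
  refine ⟨C, fun x hx hxc => ?_⟩
  have := hC x hx
  rwa [Function.update_of_ne hxc, Real.norm_eq_abs] at this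

theorem ext_of_mem (f : unitInterval → unitInterval) {x : ℝ} (hx : x ∈ Icc (0 : ℝ) 1) :
    ext f x = f ⟨x, hx⟩ := by
  unfold ext; rw [projIcc_of_mem zero_le_one hx]

namespace CI

/-- `h ∘ f - h` is bounded on `(0,1)` for every `f ∈ C(I)`. -/
theorem exists_dh_self_le (f : CI) :
    ∃ C : ℝ, ∀ x : OpenUnit, |h (f.restr x) - h x| ≤ C := by
  have hcont : Continuous (ext f.toFun) :=
    continuous_subtype_val.comp (f.continuous_toFun.comp continuous_projIcc)
  have e0 : ext f.toFun 0 = 0 := by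
    rw [ext_of_mem f.toFun (left_mem_Icc.2 zero_le_one)]
    exact congrArg Subtype.val f.map_zero
  have e1 : ext f.toFun 1 = 1 := by
    rw [ext_of_mem f.toFun (right_mem_Icc.2 zero_le_one)]
    exact congrArg Subtype.val f.map_one
  have eo : ∀ x : ℝ, ∀ hx : x ∈ Ioo (0 : ℝ) 1, ext f.toFun x ∈ Ioo (0 : ℝ) 1 := by
    intro x hx
    rw [ext_of_mem f.toFun (Ioo_subset_Icc_self hx)]
    exact f.map_open ⟨x, hx⟩
  obtain ⟨C0, hC0⟩ := exists_abs_log_slope_le (left_mem_Icc.2 zero_le_one) hcont.continuousOn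
    f.differentiable_zero.hasDerivWithinAt f.deriv_zero_pos (by
      intro x hx hx0
      have hxp : 0 < x := lt_of_le_of_ne hx.1 (Ne.symm hx0)
      rw [slope_def_field, e0]
      refine div_pos ?_ (by linarith)
      rcases eq_or_lt_of_le hx.2 with h1 | h1
      · rw [h1, e1]; norm_num
      · linarith [(eo x ⟨hxp, h1⟩).1])
  obtain ⟨C1, hC1⟩ := exists_abs_log_slope_le (right_mem_Icc.2 zero_le_one) hcont.continuousOn
    f.differentiable_one.hasDerivWithinAt f.deriv_one_pos (by
      intro x hx hx1
      have hxp : x < 1 := lt_of_le_of_ne hx.2 hx1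
      rw [slope_def_field, e1]
      refine div_pos_of_neg_of_neg ?_ (by linarith)
      rcases eq_or_lt_of_le hx.1 with h1 | h1
      · rw [← h1, e0]; norm_num
      · linarith [(eo x ⟨h1, hxp⟩).2])
  refine ⟨C0 + C1 + 2 * Real.log 2, fun x => ?_⟩
  obtain ⟨x, hx⟩ := x
  have hf : ((f.restr ⟨x, hx⟩ : OpenUnit) : ℝ) = ext f.toFun x :=
    (ext_of_mem f.toFun (Ioo_subset_Icc_self hx)).symm
  have hfx := eo x hx
  have b0 := hC0 x (Ioo_subset_Icc_self hx) hx.1.ne'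
  have b1 := hC1 x (Ioo_subset_Icc_self hx) hx.2.ne
  rw [slope_def_field, e0, sub_zero, sub_zero, Real.log_div hfx.1.ne' hx.1.ne'] at b0
  have : (ext f.toFun x - ext f.toFun 1) / (x - 1) = (1 - ext f.toFun x) / (1 - x) := by
    rw [e1, ← neg_div_neg_eq, neg_sub, neg_sub]
  rw [slope_def_field, this, Real.log_div (by linarith [hfx.2]) (by linarith [hx.2])] at b1
  have c0 := abs_h_sub_logit_le hx
  have c1 := abs_h_sub_logit_le hfx
  rw [hf]
  rw [abs_le] at *
  constructor <;> linarith [b0.1, b0.2, b1.1, b1.2, c0.1, c0.2, c1.1, c1.2]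

/-- The distances `d_h(f(x), g(x))`, for `x ∈ (0,1)`, are bounded. -/
theorem bddAbove_dh (f g : CI) :
    BddAbove (range fun x : OpenUnit => dh (f.restr x) (g.restr x)) := by
  obtain ⟨C, hC⟩ := f.exists_dh_self_le
  obtain ⟨D, hD⟩ := g.exists_dh_self_le
  refine ⟨C + D, ?_⟩
  rintro _ ⟨x, rfl⟩
  have h1 := hC x
  have h2 := hD x
  simp only [dh]
  rw [abs_le] at *
  constructor <;> linarith [h1.1, h1.2, h2.1, h2.2]

/-- The supremum distance `d_{C(I)}(f,g) = sup_{x ∈ (0,1)} d_h(f(x), g(x))`. -/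
instance : Dist CI := ⟨fun f g => ⨆ x : OpenUnit, dh (f.restr x) (g.restr x)⟩

theorem dist_def (f g : CI) : dist f g = ⨆ x : OpenUnit, dh (f.restr x) (g.restr x) := rfl

theorem dh_le_dist (f g : CI) (x : OpenUnit) : dh (f.restr x) (g.restr x) ≤ dist f g :=
  le_ciSup (bddAbove_dh f g) x

instance : Nonempty OpenUnit := ⟨⟨1 / 2, by norm_num, by norm_num⟩⟩

theorem ext_restr {f g : CI} (hfg : ∀ x, f.restr x = g.restr x) : f = g := by
  have : f.toFun = g.toFun := by
    funext x
    by_cases h0 : x = 0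
    · rw [h0, f.map_zero, g.map_zero]
    by_cases h1 : x = 1
    · rw [h1, f.map_one, g.map_one]
    have hx : (x : ℝ) ∈ Ioo (0 : ℝ) 1 :=
      ⟨lt_of_le_of_ne x.2.1 fun h => h0 (Subtype.ext h.symm),
        lt_of_le_of_ne x.2.2 fun h => h1 (Subtype.ext h)⟩
    exact Subtype.ext (congrArg (fun y : OpenUnit => (y : ℝ)) (hfg ⟨x, hx⟩))
  cases f
  cases g
  cases this
  rfl

/-- `d_{C(I)}` is a metric. -/
instance : MetricSpace CI where
  dist_self f := by simp [dist_def, dh]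
  dist_comm f g := by simp only [dist_def, dh, abs_sub_comm]
  dist_triangle f g k := by
    rw [dist_def f k]
    refine ciSup_le fun x => ?_
    exact (abs_sub_le _ (h (g.restr x)) _).trans (add_le_add (dh_le_dist f g x) (dh_le_dist g k x))
  eq_of_dist_eq_zero {f g} hfg := by
    refine ext_restr fun x => ?_
    have h1 := dh_le_dist f g x
    rw [hfg] at h1
    have h2 : h (f.restr x) = h (g.restr x) :=
      sub_eq_zero.1 (abs_eq_zero.1 (le_antisymm h1 (abs_nonneg _)))
    exact Subtype.ext (h_injOn (f.restr x).2 (g.restr x).2 h2)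

end CI

/-- The conditions on a triple `(f₀, f₁, p) ∈ C(I) × C(I) × [0,1]` that define `RDS(I)`. -/
structure IsRDS (f : CI × CI × unitInterval) : Prop where
  homeomorph_left : IsHomeomorph f.1.toFun
  homeomorph_right : IsHomeomorph f.2.1.toFun
  below_diagonal : ∀ x : OpenUnit, f.1.restr x < x
  above_diagonal : ∀ x : OpenUnit, x < f.2.1.restr x
  prob_mem : (f.2.2 : ℝ) ∈ Ioo (0 : ℝ) 1
  lyapunov_zero_pos :
    0 < (f.2.2 : ℝ) * Real.log f.1.derivZero + (1 - (f.2.2 : ℝ)) * Real.log f.2.1.derivZero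
  lyapunov_one_pos :
    0 < (f.2.2 : ℝ) * Real.log f.1.derivOne + (1 - (f.2.2 : ℝ)) * Real.log f.2.1.derivOne

/-- The space `RDS(I)`. As a subtype of a product it carries the maximum metric `d_m`. -/
abbrev RDS : Type := {f : CI × CI × unitInterval // IsRDS f}

namespace RDS

/-- The map `f₀`, applied with probability `p_f`. -/
def left (f : RDS) : CI := f.1.1

/-- The map `f₁`, applied with probability `1 - p_f`. -/
def right (f : RDS) : CI := f.1.2.1

/-- The probability `p_f`. -/
def prob (f : RDS) : ℝ := f.1.2.2

/-- The metric of `RDS(I)` is the maximal metric `d_m`. -/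
theorem dist_eq (f g : RDS) :
    dist f g = max (dist f.left g.left) (max (dist f.right g.right) |f.prob - g.prob|) := rfl

/-- The Markov operator `P_f μ = p_f • (f₀)_* μ + (1 - p_f) • (f₁)_* μ`. -/
def markov (f : RDS) (μ : Measure OpenUnit) : Measure OpenUnit :=
  ENNReal.ofReal f.prob • μ.map f.left.restr + ENNReal.ofReal (1 - f.prob) • μ.map f.right.restr

theorem markov_apply (f : RDS) (μ : Measure OpenUnit) {A : Set OpenUnit} (hA : MeasurableSet A) :
    f.markov μ A = ENNReal.ofReal f.prob * μ (f.left.restr ⁻¹' A) +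
      ENNReal.ofReal (1 - f.prob) * μ (f.right.restr ⁻¹' A) := by
  simp [markov, Measure.map_apply f.left.continuous_restr.measurable hA,
    Measure.map_apply f.right.continuous_restr.measurable hA]

/-- A probability measure `μ` on `(0,1)` is stationary for `f` if `P_f μ = μ`. -/
def IsStationary (f : RDS) (μ : ProbabilityMeasure OpenUnit) : Prop :=
  f.markov (μ : Measure OpenUnit) = (μ : Measure OpenUnit)

end RDS

end RandomInterval

end

/-!
# Stationary measures of random pairs of interval homeomorphisms

*Uniqueness* is a maximum principle. The masses of the atoms of a stationary measure, and the
difference of the distribution functions of two stationary measures, are functions `u` on `(0,1)`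
whose value at a point is the mean, with weights `p` and `1 - p`, of the values at its preimages
under `f₀` and `f₁` (`RDS.exists_gt_of_mean`). A maximum is therefore also attained at the preimage
under `f₀`, which lies strictly to the right. If a positive maximum is attained on a compact set,
its largest point contradicts this. Hence there are no atoms
(`RDS.IsStationary.nullSingleton`), distribution functions are continuous, and two of them agree
(`RDS.IsStationary.eq`). Only the position of the graphs relative to the diagonal matters here.

*Existence and continuity* come from a drift condition. In the coordinate `h` the map `fᵢ` is
asymptotically a translation at either end, by `log fᵢ'(0)` and by `-log fᵢ'(1)`. The Lyapunov
exponents being positive, the function `exp(α |h x|)` is contracted on average near the endpoints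
for small `α > 0`, so it satisfies a drift inequality (`RDS.exists_drift`); its sublevel sets being
compact, bounds on its mean give tightness. Cesàro means of the iterates of a Dirac mass then have a
limit point, which is stationary (`RDS.exists_isStationary_mem_closure`). Since `d_m` is measured
in the coordinate `h`, the drift inequality is uniform in a neighbourhood of `f`
(`RDS.exists_eventually_drift`), so nearby stationary measures lie in one compact set. A limit point
of theirs at `f` is stationary for `f` (`RDS.isStationary_of_tendsto`), hence equal to `μ_f`.
-/

open Filter Topology BoundedContinuousFunction

namespace RandomInterval

/-! ### The fibre maps as increasing bijections of the open interval -/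

theorem CI.exists_restr_eq (f : CI) (x : OpenUnit) : ∃ y : OpenUnit, f.restr y = x := by
  obtain ⟨y, hy⟩ := f.surjective_toFun x.incl
  have hx : (f.toFun y : ℝ) = x := congrArg Subtype.val hy
  have h0 : (y : ℝ) ≠ 0 := fun h => by
    rw [show y = 0 from Subtype.ext h, f.map_zero] at hx
    exact x.2.1.ne hx
  have h1 : (y : ℝ) ≠ 1 := fun h => by
    rw [show y = 1 from Subtype.ext h, f.map_one] at hx
    exact x.2.2.ne hx.symm
  exact ⟨⟨y, lt_of_le_of_ne y.2.1 h0.symm, lt_of_le_of_ne y.2.2 h1⟩, Subtype.ext hx⟩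

theorem CI.strictMono_restr (f : CI) (hf : IsHomeomorph f.toFun) : StrictMono f.restr := by
  have h : StrictMono f.toFun := by
    refine f.continuous_toFun.strictMono_of_inj_boundedOrder ?_ hf.injective
    change f.toFun 0 ≤ f.toFun 1
    rw [f.map_zero, f.map_one]
    exact zero_le_one
  intro x y hxy
  exact h (show x.incl < y.incl from hxy)

theorem preimage_Iic_of_strictMono {g : OpenUnit → OpenUnit} (hg : StrictMono g) (y : OpenUnit) :
    g ⁻¹' Iic (g y) = Iic y := by
  ext z
  simp [hg.le_iff_le]

theorem preimage_singleton_of_strictMono {g : OpenUnit → OpenUnit} (hg : StrictMono g)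
    (y : OpenUnit) : g ⁻¹' {g y} = {y} := by
  ext z
  simp [hg.injective.eq_iff]

namespace RDS

theorem prob_pos (f : RDS) : 0 < f.prob := f.2.prob_mem.1

theorem prob_lt_one (f : RDS) : f.prob < 1 := f.2.prob_mem.2

theorem exists_left_eq (f : RDS) (x : OpenUnit) : ∃ y, x < y ∧ f.left.restr y = x := by
  obtain ⟨y, rfl⟩ := f.left.exists_restr_eq x
  exact ⟨y, f.2.below_diagonal y, rfl⟩

theorem exists_right_eq (f : RDS) (x : OpenUnit) : ∃ y, f.right.restr y = x :=
  f.right.exists_restr_eq x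

theorem strictMono_left (f : RDS) : StrictMono f.left.restr :=
  f.left.strictMono_restr f.2.homeomorph_left

theorem strictMono_right (f : RDS) : StrictMono f.right.restr :=
  f.right.strictMono_restr f.2.homeomorph_right

theorem IsStationary.measureReal_eq {f : RDS} {μ : ProbabilityMeasure OpenUnit}
    (hμ : f.IsStationary μ) {A : Set OpenUnit} (hA : MeasurableSet A) :
    (μ : Measure OpenUnit).real A = f.prob * (μ : Measure OpenUnit).real (f.left.restr ⁻¹' A) +
      (1 - f.prob) * (μ : Measure OpenUnit).real (f.right.restr ⁻¹' A) := by
  have h := f.markov_apply (μ : Measure OpenUnit) hA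
  rw [show f.markov (μ : Measure OpenUnit) = μ from hμ] at h
  rw [Measure.real, h, ENNReal.toReal_add (by finiteness) (by finiteness), ENNReal.toReal_mul,
    ENNReal.toReal_mul, ENNReal.toReal_ofReal f.prob_pos.le,
    ENNReal.toReal_ofReal (sub_nonneg.2 f.prob_lt_one.le)]
  rfl

/-! ### Uniqueness of the stationary measure -/

/-- The maximum principle: a value which is a weighted mean of the values at preimages, and is not
exceeded by them, is attained at the preimage under the lower map, which lies further right. -/
theorem exists_gt_of_mean (f : RDS) {u : OpenUnit → ℝ} {z : OpenUnit}
    (hmean : ∀ y y', f.left.restr y = z → f.right.restr y' = z →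
      u z = f.prob * u y + (1 - f.prob) * u y')
    (hmax : ∀ x, u x ≤ u z) : ∃ y, z < y ∧ u z ≤ u y := by
  obtain ⟨y, hy, hyz⟩ := f.exists_left_eq z
  obtain ⟨y', hyz'⟩ := f.exists_right_eq z
  refine ⟨y, hy, ?_⟩
  have h := hmean y y' hyz hyz'
  have h1 := hmax y'
  have h2 := f.prob_pos
  have h3 := f.prob_lt_one
  by_contra! hc
  nlinarith

/-- The atoms of maximal mass form a finite set without a largest element. -/
theorem IsStationary.nullSingleton {f : RDS} {μ : ProbabilityMeasure OpenUnit}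
    (hμ : f.IsStationary μ) (x : OpenUnit) : (μ : Measure OpenUnit) {x} = 0 := by
  by_contra hx
  set u : OpenUnit → ℝ := fun x => (μ : Measure OpenUnit).real {x} with hu
  have hx0 : 0 < u x := ENNReal.toReal_pos hx (by finiteness)
  have hfin : {y | u x ≤ u y}.Finite := by
    refine (Measure.finite_const_le_meas_of_disjoint_iUnion (μ : Measure OpenUnit)
      (As := fun y : OpenUnit => {y}) (pos_iff_ne_zero.2 hx) (fun y => measurableSet_singleton y)
      (fun a b hab => disjoint_singleton.2 hab) (by finiteness)).subset fun y hy => ?_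
    exact (ENNReal.toReal_le_toReal (by finiteness) (by finiteness)).1 hy
  obtain ⟨z, hz, hzmax⟩ := hfin.exists_maximalFor u _ ⟨x, le_refl (u x)⟩
  have hmax : ∀ y, u y ≤ u z := by
    intro y
    by_contra! hc
    exact absurd (hzmax (le_trans hz hc.le) hc.le) (not_le.2 hc)
  have hfin' : {y | u z ≤ u y}.Finite := hfin.subset fun y hy =>
    show u x ≤ u y from le_trans hz hy
  obtain ⟨w, hw, hwmax⟩ := hfin'.exists_maximalFor id _ ⟨z, le_refl (u z)⟩
  have hw' : u w = u z := le_antisymm (hmax w) hw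
  obtain ⟨y, hwy, hy⟩ := f.exists_gt_of_mean (u := u) (z := w) (fun y y' h h' => by
      have e := hμ.measureReal_eq (measurableSet_singleton w)
      nth_rewrite 2 [← h] at e
      nth_rewrite 2 [← h'] at e
      rwa [preimage_singleton_of_strictMono f.strictMono_left,
        preimage_singleton_of_strictMono f.strictMono_right] at e)
    (fun x => hw' ▸ hmax x)
  exact absurd (hwmax (hw.trans hy) hwy.le) (not_le.2 hwy)

end RDS

theorem continuous_measureReal_Iic (μ : Measure OpenUnit) [IsFiniteMeasure μ]
    (hμ : ∀ x, μ {x} = 0) : Continuous fun x => μ.real (Iic x) := by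
  have e : (fun x => μ.real (Iic x)) =
      fun x => ∫ t, (Iic x).indicator (fun _ => (1 : ℝ)) t ∂μ := by
    funext x
    rw [integral_indicator_const _ measurableSet_Iic, smul_eq_mul, mul_one]
  rw [e, continuous_iff_continuousAt]
  intro x
  refine continuousAt_of_dominated (bound := fun _ => 1) ?_ ?_ (integrable_const _) ?_
  · exact Eventually.of_forall fun y =>
      (measurable_const.indicator measurableSet_Iic).aestronglyMeasurable
  · refine Eventually.of_forall fun y => Eventually.of_forall fun t => ?_
    by_cases h : t ∈ Iic y <;> simp [h]
  · have hne : ∀ᵐ t ∂μ, t ≠ x := by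
      rw [ae_iff]
      simpa using hμ x
    filter_upwards [hne] with t ht
    rcases lt_or_gt_of_ne ht with h | h
    · refine (continuousAt_const (y := (1 : ℝ))).congr ?_
      filter_upwards [lt_mem_nhds h] with y hy
      simp [hy.le]
    · refine (continuousAt_const (y := (0 : ℝ))).congr ?_
      filter_upwards [gt_mem_nhds h] with y hy
      simp [hy]

theorem isCompact_Icc_openUnit (a b : OpenUnit) : IsCompact (Icc a b) := by
  rw [Topology.IsInducing.subtypeVal.isCompact_iff]
  convert isCompact_Icc (a := (a : ℝ)) (b := (b : ℝ)) using 1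
  ext x
  constructor
  · rintro ⟨y, hy, rfl⟩
    exact hy
  · intro hx
    exact ⟨⟨x, a.2.1.trans_le hx.1, hx.2.trans_lt b.2.2⟩, hx, rfl⟩

theorem exists_measure_compl_Icc_le (μ : Measure OpenUnit) [IsFiniteMeasure μ] {ε : ℝ}
    (hε : 0 < ε) : ∃ a b : OpenUnit, μ.real (Icc a b)ᶜ ≤ ε := by
  have : PolishSpace OpenUnit := isOpen_Ioo.polishSpace
  obtain ⟨K, hK, hle⟩ := isTightMeasureSet_iff_exists_isCompact_measure_compl_le.1
    (isTightMeasureSet_singleton (μ := μ)) (ENNReal.ofReal ε) (ENNReal.ofReal_pos.2 hε)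
  obtain ⟨a, ha⟩ := hK.bddBelow
  obtain ⟨b, hb⟩ := hK.bddAbove
  refine ⟨a, b, ?_⟩
  have hsub : K ⊆ Icc a b := fun x hx => ⟨ha hx, hb hx⟩
  have h1 : μ (Icc a b)ᶜ ≤ ENNReal.ofReal ε :=
    (measure_mono (compl_subset_compl.2 hsub)).trans (hle μ rfl)
  exact ENNReal.toReal_le_of_le_ofReal hε.le h1

namespace RDS

/-- The difference of the distribution functions of two stationary measures is continuous, vanishes
at the endpoints and obeys the maximum principle; so it has no positive values. -/
theorem IsStationary.measureReal_Iic_le {f : RDS} {μ ν : ProbabilityMeasure OpenUnit}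
    (hμ : f.IsStationary μ) (hν : f.IsStationary ν) (x : OpenUnit) :
    (μ : Measure OpenUnit).real (Iic x) ≤ (ν : Measure OpenUnit).real (Iic x) := by
  by_contra! hx
  set u : OpenUnit → ℝ := fun x =>
    (μ : Measure OpenUnit).real (Iic x) - (ν : Measure OpenUnit).real (Iic x) with hu
  have hucont : Continuous u :=
    (continuous_measureReal_Iic _ hμ.nullSingleton).sub
      (continuous_measureReal_Iic _ hν.nullSingleton)
  have hx0 : 0 < u x := sub_pos.2 hx
  obtain ⟨a, b', hab⟩ := exists_measure_compl_Icc_le (μ : Measure OpenUnit) (half_pos hx0)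
  obtain ⟨a', b, hab'⟩ := exists_measure_compl_Icc_le (ν : Measure OpenUnit) (half_pos hx0)
  have hS : {y | u x ≤ u y} ⊆ Icc a b := by
    intro y hy
    have hy : u x ≤ (μ : Measure OpenUnit).real (Iic y) - (ν : Measure OpenUnit).real (Iic y) := hy
    constructor
    · by_contra! hya
      have h1 : (μ : Measure OpenUnit).real (Iic y) ≤ (μ : Measure OpenUnit).real (Icc a b')ᶜ :=
        measureReal_mono fun z hz hz' => absurd (hz'.1.trans hz) (not_le.2 hya)
      have h2 : 0 ≤ (ν : Measure OpenUnit).real (Iic y) := measureReal_nonneg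
      linarith
    · by_contra! hyb
      have h1 : (ν : Measure OpenUnit).real (Iic y)ᶜ ≤ (ν : Measure OpenUnit).real (Icc a' b)ᶜ :=
        measureReal_mono (compl_subset_compl.2 fun z hz => hz.2.trans hyb.le)
      have h2 : (μ : Measure OpenUnit).real (Iic y) ≤ 1 := measureReal_le_one
      rw [probReal_compl_eq_one_sub measurableSet_Iic] at h1
      linarith
  have hScomp : IsCompact {y | u x ≤ u y} :=
    (isCompact_Icc_openUnit a b).of_isClosed_subset (isClosed_le continuous_const hucont) hS
  obtain ⟨z, hz, hzmax⟩ := hScomp.exists_isMaxOn ⟨x, le_refl (u x)⟩ hucont.continuousOn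
  have hmax : ∀ y, u y ≤ u z := by
    intro y
    rcases le_total (u x) (u y) with h | h
    · exact hzmax h
    · exact h.trans hz
  have hT : IsCompact {y | u z ≤ u y} :=
    hScomp.of_isClosed_subset (isClosed_le continuous_const hucont) fun y hy =>
      show u x ≤ u y from le_trans hz hy
  obtain ⟨w, hw, hwmax⟩ := hT.exists_isGreatest ⟨z, le_refl (u z)⟩
  have hw' : u w = u z := le_antisymm (hmax w) hw
  obtain ⟨y, hwy, hy⟩ := f.exists_gt_of_mean (u := u) (z := w) (fun y y' h h' => by
      have e := hμ.measureReal_eq (measurableSet_Iic (a := w))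
      have e' := hν.measureReal_eq (measurableSet_Iic (a := w))
      nth_rewrite 2 [← h] at e e'
      nth_rewrite 2 [← h'] at e e'
      rw [preimage_Iic_of_strictMono f.strictMono_left,
        preimage_Iic_of_strictMono f.strictMono_right] at e e'
      simp only [hu, e, e']
      ring)
    (fun x => hw' ▸ hmax x)
  exact absurd (hwmax (hw.trans hy)) (not_le.2 hwy)

theorem IsStationary.eq {f : RDS} {μ ν : ProbabilityMeasure OpenUnit}
    (hμ : f.IsStationary μ) (hν : f.IsStationary ν) : μ = ν := by
  refine Subtype.ext (Measure.ext_of_Iic (μ : Measure OpenUnit) (ν : Measure OpenUnit) fun x => ?_)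
  exact (measureReal_eq_measureReal_iff (measure_ne_top _ _) (measure_ne_top _ _)).1
    (le_antisymm (hμ.measureReal_Iic_le hν x) (hν.measureReal_Iic_le hμ x))

end RDS

/-! ### The Lyapunov function and its drift -/

theorem abs_h_of_le_half {x : ℝ} (hx0 : 0 < x) (hx : x ≤ 1 / 2) :
    |h x| = -(Real.log x - Real.log (1 / 2)) := by
  have h1 : Real.log x ≤ Real.log (1 / 2) := Real.log_le_log hx0 hx
  rw [h, if_pos hx, abs_of_nonpos (by linarith)]

theorem abs_h_of_half_lt {x : ℝ} (hx1 : x < 1) (hx : 1 / 2 < x) :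
    |h x| = -(Real.log (1 - x) - Real.log (1 / 2)) := by
  have h1 : Real.log (1 - x) ≤ Real.log (1 / 2) := Real.log_le_log (by linarith) (by linarith)
  rw [h, if_neg (not_le.2 hx), abs_of_nonneg (by linarith)]
  ring

theorem CI.continuous_ext (f : CI) : Continuous (ext f.toFun) :=
  continuous_subtype_val.comp (f.continuous_toFun.comp continuous_projIcc)

theorem CI.ext_zero (f : CI) : ext f.toFun 0 = 0 := by
  rw [ext_of_mem f.toFun (left_mem_Icc.2 zero_le_one)]
  exact congrArg Subtype.val f.map_zero

theorem CI.ext_one (f : CI) : ext f.toFun 1 = 1 := by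
  rw [ext_of_mem f.toFun (right_mem_Icc.2 zero_le_one)]
  exact congrArg Subtype.val f.map_one

theorem CI.ext_coe (f : CI) (x : OpenUnit) : ext f.toFun x = f.restr x :=
  ext_of_mem f.toFun (Ioo_subset_Icc_self x.2)

/-- The filter of neighbourhoods of the endpoint `c` in `(0,1)`. -/
abbrev nhdsEnd (c : ℝ) : Filter OpenUnit := comap Subtype.val (𝓝 c)

theorem tendsto_coe_nhdsEnd {c : ℝ} (hc : c ∉ Ioo (0 : ℝ) 1) :
    Tendsto (Subtype.val : OpenUnit → ℝ) (nhdsEnd c) (𝓝[Icc 0 1 \ {c}] c) := by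
  refine tendsto_nhdsWithin_iff.2 ⟨tendsto_comap, Eventually.of_forall fun x => ?_⟩
  exact ⟨Ioo_subset_Icc_self x.2, fun hx => hc (hx ▸ x.2)⟩

/-- In the logarithmic coordinate, `f` acts near `0` as the translation by `log f'(0)`. -/
theorem CI.tendsto_abs_h_zero (f : CI) :
    Tendsto (fun x : OpenUnit => |h (f.restr x)| - |h x|) (nhdsEnd 0)
      (𝓝 (-Real.log f.derivZero)) := by
  have h1 := (hasDerivWithinAt_iff_tendsto_slope.1 f.differentiable_zero.hasDerivWithinAt).comp
    (tendsto_coe_nhdsEnd (c := 0) (by simp))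
  have h2 : Tendsto (Subtype.val : OpenUnit → ℝ) (nhdsEnd 0) (𝓝 0) := tendsto_comap
  have h3 : Tendsto (fun x : OpenUnit => ext f.toFun x) (nhdsEnd 0) (𝓝 0) := by
    simpa only [f.ext_zero] using! (f.continuous_ext.tendsto 0).comp h2
  refine ((h1.log f.deriv_zero_pos.ne').neg).congr' ?_
  filter_upwards [h2.eventually_lt_const (by norm_num : (0 : ℝ) < 1 / 2),
    h3.eventually_lt_const (by norm_num : (0 : ℝ) < 1 / 2)] with x hx hfx
  rw [f.ext_coe] at hfx
  rw [abs_h_of_le_half x.2.1 hx.le, abs_h_of_le_half (f.restr x).2.1 hfx.le, Function.comp_apply,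
    slope_def_field, f.ext_zero, f.ext_coe, sub_zero, sub_zero,
    Real.log_div (f.restr x).2.1.ne' x.2.1.ne']
  ring

/-- In the logarithmic coordinate, `f` acts near `1` as the translation by `-log f'(1)`. -/
theorem CI.tendsto_abs_h_one (f : CI) :
    Tendsto (fun x : OpenUnit => |h (f.restr x)| - |h x|) (nhdsEnd 1)
      (𝓝 (-Real.log f.derivOne)) := by
  have h1 := (hasDerivWithinAt_iff_tendsto_slope.1 f.differentiable_one.hasDerivWithinAt).comp
    (tendsto_coe_nhdsEnd (c := 1) (by simp))
  have h2 : Tendsto (Subtype.val : OpenUnit → ℝ) (nhdsEnd 1) (𝓝 1) := tendsto_comap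
  have h3 : Tendsto (fun x : OpenUnit => ext f.toFun x) (nhdsEnd 1) (𝓝 1) := by
    simpa only [f.ext_one] using! (f.continuous_ext.tendsto 1).comp h2
  refine ((h1.log f.deriv_one_pos.ne').neg).congr' ?_
  filter_upwards [h2.eventually_const_lt (by norm_num : (1 / 2 : ℝ) < 1),
    h3.eventually_const_lt (by norm_num : (1 / 2 : ℝ) < 1)] with x hx hfx
  rw [f.ext_coe] at hfx
  have e : ((f.restr x : ℝ) - 1) / ((x : ℝ) - 1) = (1 - (f.restr x : ℝ)) / (1 - (x : ℝ)) := by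
    rw [← neg_div_neg_eq, neg_sub, neg_sub]
  rw [abs_h_of_half_lt x.2.2 hx, abs_h_of_half_lt (f.restr x).2.2 hfx, Function.comp_apply,
    slope_def_field, f.ext_one, f.ext_coe, e,
    Real.log_div (sub_pos.2 (f.restr x).2.2).ne' (sub_pos.2 x.2.2).ne']
  ring

/-- The Lyapunov function `exp(α |h x|)`, which is `(2 min(x, 1 - x))^(-α)`. -/
noncomputable def lyap (α : ℝ) (x : OpenUnit) : ℝ := Real.exp (α * |h x|)

theorem lyap_pos (α : ℝ) (x : OpenUnit) : 0 < lyap α x := Real.exp_pos _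

theorem measurable_lyap (α : ℝ) : Measurable (lyap α) := by
  have hm : Measurable h := by
    unfold h
    exact Measurable.ite measurableSet_Iic (Real.measurable_log.sub_const _)
      ((Real.measurable_log.comp (measurable_const.sub measurable_id)).const_sub _)
  exact Real.measurable_exp.comp
    (((continuous_abs.measurable.comp (hm.comp measurable_subtype_coe))).const_mul α)

theorem lyap_mul_exp_sub (α : ℝ) (x y : OpenUnit) :
    Real.exp (α * (|h y| - |h x|)) * lyap α x = lyap α y := by
  rw [lyap, lyap, ← Real.exp_add]
  congr 1
  ring

/-- A pair of translations of positive mean contracts the exponential weight `exp(-α t)` for all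
small `α > 0`, since the derivative of the mean at `α = 0` is negative. -/
theorem eventually_mean_exp_lt_one {p a b : ℝ} (hpos : 0 < p * a + (1 - p) * b) :
    ∀ᶠ α in 𝓝[>] (0 : ℝ), p * Real.exp (α * -a) + (1 - p) * Real.exp (α * -b) < 1 := by
  have hd : HasDerivAt (fun α : ℝ => p * Real.exp (α * -a) + (1 - p) * Real.exp (α * -b))
      (-(p * a + (1 - p) * b)) 0 := by
    have h1 : ∀ c : ℝ, HasDerivAt (fun α : ℝ => Real.exp (α * -c)) (-c) 0 := fun c => by
      simpa using ((hasDerivAt_id (0 : ℝ)).mul_const (-c)).exp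
    exact (((h1 a).const_mul p).add ((h1 b).const_mul (1 - p))).congr_deriv (by ring)
  have hs := (hasDerivAt_iff_tendsto_slope.1 hd).eventually_lt_const (neg_neg_of_pos hpos)
  have hs' := hs.filter_mono (nhdsWithin_mono 0 (fun x (hx : 0 < x) => ne_of_gt hx))
  filter_upwards [hs', self_mem_nhdsWithin] with α hα hα0
  have hα0 : 0 < α := hα0
  rw [slope_def_field, div_neg_iff] at hα
  simp only [zero_mul, Real.exp_zero, sub_zero] at hα
  rcases hα with hα | hα
  · linarith [hα.2]
  · linarith [hα.1]

theorem exists_compl_Icc_of_nhdsEnd {P : OpenUnit → Prop} (h0 : ∀ᶠ x in nhdsEnd 0, P x)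
    (h1 : ∀ᶠ x in nhdsEnd 1, P x) :
    ∃ δ : ℝ, 0 < δ ∧ ∀ x : OpenUnit, (x : ℝ) < δ ∨ 1 - δ < x → P x := by
  obtain ⟨s, hs, hs'⟩ := h0
  obtain ⟨t, ht, ht'⟩ := h1
  obtain ⟨δ, hδ, hδs⟩ := Metric.mem_nhds_iff.1 hs
  obtain ⟨η, hη, hηt⟩ := Metric.mem_nhds_iff.1 ht
  refine ⟨min δ η, lt_min hδ hη, fun x hx => ?_⟩
  have hx0 := x.2.1
  have hx1 := x.2.2
  rcases hx with hx | hx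
  · refine hs' (hδs ?_)
    rw [Metric.mem_ball, Real.dist_eq, sub_zero, abs_of_pos hx0]
    exact hx.trans_le (min_le_left _ _)
  · refine ht' (hηt ?_)
    rw [Metric.mem_ball, Real.dist_eq, abs_of_neg (by linarith)]
    linarith [min_le_right δ η]

theorem abs_h_le_of_mem {δ : ℝ} (hδ : 0 < δ) {x : OpenUnit} (hx : δ ≤ x) (hx' : (x : ℝ) ≤ 1 - δ) :
    |h x| ≤ Real.log 2 - 2 * Real.log δ := by
  have h1 := abs_h_sub_logit_le x.2
  have h2 : Real.log δ ≤ Real.log x := Real.log_le_log hδ hx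
  have h3 : Real.log δ ≤ Real.log (1 - x) := Real.log_le_log hδ (by linarith)
  have h4 : Real.log x ≤ 0 := Real.log_nonpos x.2.1.le x.2.2.le
  have h5 : Real.log (1 - x) ≤ 0 :=
    Real.log_nonpos (by linarith [x.2.2]) (by linarith [x.2.1])
  rw [abs_le] at *
  constructor <;> linarith [h1.1, h1.2]

namespace RDS

/-- The average of the Lyapunov function after one step is at most `ρ < 1` times its value near the
endpoints, and is bounded on the compact rest of `(0,1)`. -/
theorem exists_drift (f : RDS) : ∃ α > 0, ∃ ρ > 0, ρ < 1 ∧ ∃ C ≥ 0, ∀ x : OpenUnit,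
    f.prob * lyap α (f.left.restr x) + (1 - f.prob) * lyap α (f.right.restr x) ≤
      ρ * lyap α x + C := by
  have hp := f.prob_pos
  have hp1 := f.prob_lt_one
  obtain ⟨α, ⟨hα0, hα1⟩, hα⟩ := (((eventually_mean_exp_lt_one f.2.lyapunov_zero_pos).and
    (eventually_mean_exp_lt_one f.2.lyapunov_one_pos)).and self_mem_nhdsWithin).exists
  have hα : 0 < α := hα
  obtain ⟨ρ, hρ, hρ1⟩ := exists_between (max_lt hα0 hα1)
  have hρ0 : 0 < ρ := by
    refine lt_trans ?_ ((le_max_left _ _).trans_lt hρ)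
    change 0 < f.prob * _ + (1 - f.prob) * _
    have : 0 < 1 - f.prob := sub_pos.2 hp1
    positivity
  have key : ∀ (l : Filter OpenUnit) (a b : ℝ),
      Tendsto (fun x : OpenUnit => |h (f.left.restr x)| - |h x|) l (𝓝 (-a)) →
      Tendsto (fun x : OpenUnit => |h (f.right.restr x)| - |h x|) l (𝓝 (-b)) →
      f.prob * Real.exp (α * -a) + (1 - f.prob) * Real.exp (α * -b) < ρ →
      ∀ᶠ x in l, f.prob * lyap α (f.left.restr x) + (1 - f.prob) * lyap α (f.right.restr x) ≤
        ρ * lyap α x := by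
    intro l a b ha hb hab
    have h1 := (((ha.const_mul α).rexp.const_mul f.prob).add
      ((hb.const_mul α).rexp.const_mul (1 - f.prob))).eventually_lt_const hab
    filter_upwards [h1] with x hx
    have := mul_le_mul_of_nonneg_right hx.le (lyap_pos α x).le
    rwa [add_mul, mul_assoc, mul_assoc, lyap_mul_exp_sub, lyap_mul_exp_sub] at this
  obtain ⟨δ, hδ, hδP⟩ := exists_compl_Icc_of_nhdsEnd
    (key _ _ _ f.left.tendsto_abs_h_zero f.right.tendsto_abs_h_zero
      ((le_max_left _ _).trans_lt hρ))
    (key _ _ _ f.left.tendsto_abs_h_one f.right.tendsto_abs_h_one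
      ((le_max_right _ _).trans_lt hρ))
  obtain ⟨A, hA⟩ := f.left.exists_dh_self_le
  obtain ⟨B, hB⟩ := f.right.exists_dh_self_le
  set M := Real.log 2 - 2 * Real.log δ
  refine ⟨α, hα, ρ, hρ0, hρ1, Real.exp (α * (M + max A B)), (Real.exp_pos _).le, fun x => ?_⟩
  have hV := mul_pos hρ0 (lyap_pos α x)
  by_cases hx : (x : ℝ) < δ ∨ 1 - δ < x
  · exact (hδP x hx).trans (le_add_of_nonneg_right (Real.exp_pos _).le)
  · push Not at hx
    have h1 := abs_h_le_of_mem hδ hx.1 hx.2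
    have bound : ∀ y : OpenUnit, |h y - h x| ≤ max A B →
        lyap α y ≤ Real.exp (α * (M + max A B)) := fun y hy => by
      refine Real.exp_le_exp.2 (mul_le_mul_of_nonneg_left ?_ hα.le)
      have := abs_sub_abs_le_abs_sub (h y) (h x)
      linarith
    have b1 := mul_le_mul_of_nonneg_left (bound _ ((hA x).trans (le_max_left A B))) hp.le
    have b2 := mul_le_mul_of_nonneg_left (bound _ ((hB x).trans (le_max_right A B)))
      (sub_nonneg.2 hp1.le)
    linarith

theorem continuous_left : Continuous left := continuous_fst.comp continuous_subtype_val

theorem continuous_right : Continuous right :=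
  continuous_fst.comp (continuous_snd.comp continuous_subtype_val)

theorem continuous_prob : Continuous prob :=
  continuous_subtype_val.comp (continuous_snd.comp (continuous_snd.comp continuous_subtype_val))

end RDS

theorem lyap_le_of_dist {α : ℝ} (hα : 0 ≤ α) (f g : CI) (x : OpenUnit) :
    lyap α (g.restr x) ≤ Real.exp (α * dist g f) * lyap α (f.restr x) := by
  rw [lyap, lyap, ← Real.exp_add, ← mul_add]
  refine Real.exp_le_exp.2 (mul_le_mul_of_nonneg_left ?_ hα)
  have h1 : |h (g.restr x) - h (f.restr x)| ≤ dist g f := CI.dh_le_dist g f x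
  have := abs_sub_abs_le_abs_sub (h (g.restr x)) (h (f.restr x))
  linarith

/-- The drift inequality holds uniformly near `f`: a perturbation of size `ε` in `d_m` multiplies
the Lyapunov function by at most `exp(α ε)`. -/
theorem RDS.exists_eventually_drift (f : RDS) : ∃ α > 0, ∃ ρ > 0, ρ < 1 ∧ ∃ C ≥ 0,
    ∀ᶠ g : RDS in 𝓝 f, ∀ x : OpenUnit,
      g.prob * lyap α (g.left.restr x) + (1 - g.prob) * lyap α (g.right.restr x) ≤
        ρ * lyap α x + C := by
  obtain ⟨α, hα, ρ, hρ, hρ1, C, hC, hdrift⟩ := f.exists_drift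
  -- A factor `κ > 1` is lost in the Lyapunov function and another in the probabilities;
  -- `κ² ρ < 1` because `4 ρ < (1 + ρ)²`.
  set κ : ℝ := 2 / (1 + ρ) with hκ
  have hκ1 : 1 < κ := by rw [hκ, lt_div_iff₀ (by linarith)]; linarith
  have hκρ : κ * κ * ρ < 1 := by
    have e : κ * κ * ρ = 4 * ρ / ((1 + ρ) * (1 + ρ)) := by rw [hκ]; field_simp; norm_num
    rw [e, div_lt_one (by positivity)]
    nlinarith [mul_pos (sub_pos.2 hρ1) (sub_pos.2 hρ1)]
  have hexp : ∀ k : RDS → CI, Continuous k →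
      ∀ᶠ g in 𝓝 f, Real.exp (α * dist (k g) (k f)) < κ := fun k hk => by
    have hcont : Continuous fun g => Real.exp (α * dist (k g) (k f)) := by fun_prop
    exact (hcont.tendsto f).eventually_lt_const (by simpa using hκ1)
  refine ⟨α, hα, κ * κ * ρ, by positivity, hκρ, κ * κ * C, by positivity, ?_⟩
  have hp := f.prob_pos
  have hp1 : 0 < 1 - f.prob := sub_pos.2 f.prob_lt_one
  filter_upwards [hexp _ continuous_left, hexp _ continuous_right,
    (continuous_prob.tendsto f).eventually_lt_const (lt_mul_of_one_lt_left hp hκ1),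
    ((continuous_const.sub continuous_prob).tendsto f).eventually_lt_const
      (lt_mul_of_one_lt_left hp1 hκ1)] with g h0 h1 h2 h3 x
  have h3 : 1 - g.prob < κ * (1 - f.prob) := h3
  have l0 := (lyap_le_of_dist hα.le f.left g.left x).trans
    (mul_le_mul_of_nonneg_right h0.le (lyap_pos α _).le)
  have l1 := (lyap_le_of_dist hα.le f.right g.right x).trans
    (mul_le_mul_of_nonneg_right h1.le (lyap_pos α _).le)
  have m0 := mul_le_mul h2.le l0 (lyap_pos α _).le (by positivity)
  have m1 := mul_le_mul h3.le l1 (lyap_pos α _).le (by positivity)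
  have := mul_le_mul_of_nonneg_left (hdrift x) (by positivity : 0 ≤ κ * κ)
  linarith

/-! ### Tightness of the sublevel sets of the Lyapunov integral -/

theorem mem_Icc_of_abs_h_le {t : ℝ} (ht : 0 ≤ t) {x : ℝ} (hx : x ∈ Ioo (0 : ℝ) 1)
    (hxt : |h x| ≤ t) : x ∈ Icc (Real.exp (-t) / 2) (1 - Real.exp (-t) / 2) := by
  have h1 : Real.exp (-t) ≤ 1 := Real.exp_le_one_iff.2 (by linarith)
  have key : ∀ y : ℝ, 0 < y → -(Real.log y - Real.log (1 / 2)) ≤ t → Real.exp (-t) / 2 ≤ y := by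
    intro y hy hyt
    have h2 : Real.log (Real.exp (-t) * (1 / 2)) ≤ Real.log y := by
      rw [Real.log_mul (Real.exp_pos _).ne' (by norm_num), Real.log_exp]
      linarith
    have := (Real.log_le_log_iff (by positivity) hy).1 h2
    linarith
  rcases le_or_gt x (1 / 2) with h2 | h2
  · rw [abs_h_of_le_half hx.1 h2] at hxt
    exact ⟨key x hx.1 hxt, by linarith⟩
  · rw [abs_h_of_half_lt hx.2 h2] at hxt
    have := key (1 - x) (by linarith [hx.2]) hxt
    exact ⟨by linarith, by linarith⟩

/-- The probability measures for which the Lyapunov function has mean at most `R`. -/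
def lyapBall (α R : ℝ) : Set (ProbabilityMeasure OpenUnit) :=
  {μ | ∫⁻ x, ENNReal.ofReal (lyap α x) ∂(μ : Measure OpenUnit) ≤ ENNReal.ofReal R}

theorem isTightMeasureSet_lyapBall {α : ℝ} (hα : 0 < α) (R : ℝ) :
    IsTightMeasureSet {ν : Measure OpenUnit | ∃ μ ∈ lyapBall α R, (μ : Measure OpenUnit) = ν} := by
  rw [isTightMeasureSet_iff_exists_isCompact_measure_compl_le]
  intro ε hε
  have hlim : Tendsto (fun t : ℝ => ENNReal.ofReal (R / Real.exp (α * t))) atTop (𝓝 0) := by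
    have : Tendsto (fun t : ℝ => R / Real.exp (α * t)) atTop (𝓝 0) :=
      tendsto_const_nhds.div_atTop
        (Real.tendsto_exp_atTop.comp (tendsto_id.const_mul_atTop hα))
    simpa using ENNReal.tendsto_ofReal this
  obtain ⟨t, htε, ht⟩ := ((hlim.eventually_lt_const hε).and (eventually_gt_atTop 0)).exists
  have h1 : Real.exp (-t) < 1 := Real.exp_lt_one_iff.2 (by linarith)
  have h2 : 0 < Real.exp (-t) := Real.exp_pos _
  set a : OpenUnit := ⟨Real.exp (-t) / 2, by linarith, by linarith⟩
  set b : OpenUnit := ⟨1 - Real.exp (-t) / 2, by linarith, by linarith⟩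
  refine ⟨Icc a b, isCompact_Icc_openUnit a b, ?_⟩
  rintro _ ⟨μ, hμ, rfl⟩
  have hsub : (Icc a b)ᶜ ⊆
      {x | ENNReal.ofReal (Real.exp (α * t)) ≤ ENNReal.ofReal (lyap α x)} := by
    intro x hx
    refine ENNReal.ofReal_le_ofReal (Real.exp_le_exp.2 (mul_le_mul_of_nonneg_left ?_ hα.le))
    by_contra! hc
    exact hx (mem_Icc_of_abs_h_le ht.le x.2 hc.le)
  calc (μ : Measure OpenUnit) (Icc a b)ᶜ ≤ _ := measure_mono hsub
    _ ≤ (∫⁻ x, ENNReal.ofReal (lyap α x) ∂(μ : Measure OpenUnit)) /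
          ENNReal.ofReal (Real.exp (α * t)) :=
        meas_ge_le_lintegral_div (measurable_lyap α).ennreal_ofReal.aemeasurable
          (ENNReal.ofReal_pos.2 (Real.exp_pos _)).ne' ENNReal.ofReal_ne_top
    _ ≤ ENNReal.ofReal R / ENNReal.ofReal (Real.exp (α * t)) := ENNReal.div_le_div_right hμ _
    _ = ENNReal.ofReal (R / Real.exp (α * t)) := (ENNReal.ofReal_div_of_pos (Real.exp_pos _)).symm
    _ ≤ ε := htε.le

theorem isCompact_closure_lyapBall {α : ℝ} (hα : 0 < α) (R : ℝ) :
    IsCompact (closure (lyapBall α R)) :=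
  isCompact_closure_of_isTightMeasureSet (isTightMeasureSet_lyapBall hα R)

/-! ### The Markov operator and its dual -/

namespace RDS

instance isProbabilityMeasure_markov (f : RDS) (μ : Measure OpenUnit) [IsProbabilityMeasure μ] :
    IsProbabilityMeasure (f.markov μ) := by
  constructor
  rw [f.markov_apply μ MeasurableSet.univ, preimage_univ, preimage_univ, measure_univ, mul_one,
    mul_one, ← ENNReal.ofReal_add f.prob_pos.le (sub_nonneg.2 f.prob_lt_one.le),
    add_sub_cancel, ENNReal.ofReal_one]

theorem lintegral_markov_le (f : RDS) {α ρ C : ℝ} (hρ : 0 ≤ ρ) (hC : 0 ≤ C)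
    (hf : ∀ x : OpenUnit, f.prob * lyap α (f.left.restr x) +
      (1 - f.prob) * lyap α (f.right.restr x) ≤ ρ * lyap α x + C)
    (μ : Measure OpenUnit) [IsProbabilityMeasure μ] :
    ∫⁻ x, ENNReal.ofReal (lyap α x) ∂(f.markov μ) ≤
      ENNReal.ofReal ρ * ∫⁻ x, ENNReal.ofReal (lyap α x) ∂μ + ENNReal.ofReal C := by
  have hm : Measurable fun x => ENNReal.ofReal (lyap α x) := (measurable_lyap α).ennreal_ofReal
  have hp := f.prob_pos.le
  have hp1 : 0 ≤ 1 - f.prob := sub_nonneg.2 f.prob_lt_one.le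
  have h0 := f.left.continuous_restr.measurable
  have h1 := f.right.continuous_restr.measurable
  have m0 : Measurable fun x => ENNReal.ofReal (lyap α (f.left.restr x)) := hm.comp h0
  have m1 : Measurable fun x => ENNReal.ofReal (lyap α (f.right.restr x)) := hm.comp h1
  rw [markov, lintegral_add_measure, lintegral_smul_measure, lintegral_smul_measure,
    lintegral_map hm h0, lintegral_map hm h1, smul_eq_mul, smul_eq_mul,
    ← lintegral_const_mul _ m0, ← lintegral_const_mul _ m1,
    ← lintegral_const_mul _ hm, ← lintegral_add_left (m0.const_mul _)]
  calc _ ≤ ∫⁻ x, ENNReal.ofReal ρ * ENNReal.ofReal (lyap α x) + ENNReal.ofReal C ∂μ := by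
        refine lintegral_mono fun x => ?_
        have l0 := (lyap_pos α (f.left.restr x)).le
        have l1 := (lyap_pos α (f.right.restr x)).le
        have l := (lyap_pos α x).le
        rw [← ENNReal.ofReal_mul hp, ← ENNReal.ofReal_mul hp1, ← ENNReal.ofReal_mul hρ,
          ← ENNReal.ofReal_add (by positivity) (by positivity),
          ← ENNReal.ofReal_add (by positivity) hC]
        exact ENNReal.ofReal_le_ofReal (hf x)
    _ = _ := by rw [lintegral_add_right _ measurable_const, lintegral_const, measure_univ, mul_one]

/-- The dual of the Markov operator: `φ ↦ p φ ∘ f₀ + (1 - p) φ ∘ f₁`. -/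
def dual (f : RDS) (φ : OpenUnit →ᵇ ℝ) : OpenUnit →ᵇ ℝ :=
  f.prob • φ.compContinuous ⟨f.left.restr, f.left.continuous_restr⟩ +
    (1 - f.prob) • φ.compContinuous ⟨f.right.restr, f.right.continuous_restr⟩

theorem dual_apply (f : RDS) (φ : OpenUnit →ᵇ ℝ) (x : OpenUnit) :
    f.dual φ x = f.prob * φ (f.left.restr x) + (1 - f.prob) * φ (f.right.restr x) := rfl

theorem integral_markov (f : RDS) (φ : OpenUnit →ᵇ ℝ) (μ : Measure OpenUnit)
    [IsProbabilityMeasure μ] : ∫ x, φ x ∂(f.markov μ) = ∫ x, f.dual φ x ∂μ := by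
  have h0 := f.left.continuous_restr
  have h1 := f.right.continuous_restr
  have hφ := φ.continuous.aestronglyMeasurable (μ := μ.map f.left.restr)
  have hφ' := φ.continuous.aestronglyMeasurable (μ := μ.map f.right.restr)
  have : IsProbabilityMeasure (μ.map f.left.restr) :=
    Measure.isProbabilityMeasure_map h0.measurable.aemeasurable
  have : IsProbabilityMeasure (μ.map f.right.restr) :=
    Measure.isProbabilityMeasure_map h1.measurable.aemeasurable
  have i0 : Integrable (fun x => φ (f.left.restr x)) μ :=
    (φ.compContinuous ⟨f.left.restr, h0⟩).integrable μ
  have i1 : Integrable (fun x => φ (f.right.restr x)) μ :=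
    (φ.compContinuous ⟨f.right.restr, h1⟩).integrable μ
  simp only [dual_apply]
  rw [markov, integral_add_measure ((φ.integrable _).smul_measure ENNReal.ofReal_ne_top)
      ((φ.integrable _).smul_measure ENNReal.ofReal_ne_top),
    integral_smul_measure, integral_smul_measure, integral_map h0.measurable.aemeasurable hφ,
    integral_map h1.measurable.aemeasurable hφ', ENNReal.toReal_ofReal f.prob_pos.le,
    ENNReal.toReal_ofReal (sub_nonneg.2 f.prob_lt_one.le), smul_eq_mul, smul_eq_mul,
    integral_add (i0.const_mul _) (i1.const_mul _), integral_const_mul, integral_const_mul]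

end RDS

theorem sub_le_log_sub_log {a b : ℝ} (ha : 0 < a) (hab : a ≤ b) (hb : b ≤ 1) :
    b - a ≤ Real.log b - Real.log a := by
  have hb0 : 0 < b := ha.trans_le hab
  have h1 := Real.log_le_sub_one_of_pos (div_pos ha hb0)
  rw [Real.log_div ha.ne' hb0.ne'] at h1
  have h2 : b - a ≤ (b - a) / b := by
    rw [le_div_iff₀ hb0]
    nlinarith
  have h3 : (b - a) / b = 1 - a / b := by field_simp
  linarith

/-- The coordinate `h` is expanding. -/
theorem dist_le_dh (x y : OpenUnit) : dist x y ≤ dh x y := by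
  have key : ∀ x y : OpenUnit, (x : ℝ) ≤ y → (y : ℝ) - x ≤ h y - h x := by
    intro x y hxy
    have hx0 := x.2.1
    have hy1 := y.2.2
    unfold h
    split_ifs with h1 h2 h2
    · linarith [sub_le_log_sub_log hx0 hxy y.2.2.le]
    · linarith
    · linarith [sub_le_log_sub_log hx0 h2 (by norm_num),
        sub_le_log_sub_log (a := 1 - y) (b := 1 / 2) (by linarith) (by linarith) (by norm_num)]
    · linarith [sub_le_log_sub_log (a := 1 - y) (b := 1 - x) (by linarith) (by linarith)
        (by linarith)]
  rw [Subtype.dist_eq, Real.dist_eq, dh]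
  rcases le_total (x : ℝ) y with hxy | hxy
  · rw [abs_sub_comm, abs_sub_comm (h x), abs_of_nonneg (sub_nonneg.2 hxy)]
    exact (key x y hxy).trans (le_abs_self _)
  · rw [abs_of_nonneg (sub_nonneg.2 hxy)]
    exact (key y x hxy).trans (le_abs_self _)

theorem abs_sub_restr_le {φ : OpenUnit →ᵇ ℝ} {L : NNReal} (hφ : LipschitzWith L φ) (f g : CI)
    (x : OpenUnit) : |φ (g.restr x) - φ (f.restr x)| ≤ L * dist g f := by
  rw [← Real.dist_eq]
  exact (hφ.dist_le_mul _ _).trans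
    (mul_le_mul_of_nonneg_left ((dist_le_dh _ _).trans (CI.dh_le_dist g f x)) L.2)

namespace RDS

/-- For a Lipschitz test function, the dual operator depends continuously on `f` in the uniform
norm, because `d_h` dominates the Euclidean distance. -/
theorem tendsto_norm_dual_sub (f : RDS) {φ : OpenUnit →ᵇ ℝ} {L : NNReal}
    (hφ : LipschitzWith L φ) :
    Tendsto (fun g : RDS => ‖g.dual φ - f.dual φ‖) (𝓝 f) (𝓝 0) := by
  have hlim : Tendsto (fun g : RDS => L * dist g.left f.left + L * dist g.right f.right +
      |g.prob - f.prob| * (2 * ‖φ‖)) (𝓝 f) (𝓝 0) := by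
    have h0 := continuous_left
    have h1 := continuous_right
    have h2 := continuous_prob
    have hc : Continuous (fun g : RDS => L * dist g.left f.left + L * dist g.right f.right +
      |g.prob - f.prob| * (2 * ‖φ‖)) := by fun_prop
    simpa using hc.tendsto f
  refine squeeze_zero (fun g => norm_nonneg _) (fun g => ?_) hlim
  refine (BoundedContinuousFunction.norm_le (by positivity)).2 fun x => ?_
  have e : (g.dual φ - f.dual φ) x =
      g.prob * (φ (g.left.restr x) - φ (f.left.restr x)) +
      (1 - g.prob) * (φ (g.right.restr x) - φ (f.right.restr x)) +
      (g.prob - f.prob) * (φ (f.left.restr x) - φ (f.right.restr x)) := by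
    rw [BoundedContinuousFunction.sub_apply, dual_apply, dual_apply]
    ring
  have hp := g.prob_pos
  have hp1 := g.prob_lt_one
  rw [e, Real.norm_eq_abs]
  refine (abs_add_three _ _ _).trans ?_
  rw [abs_mul, abs_mul, abs_mul, abs_of_pos hp, abs_of_pos (sub_pos.2 hp1)]
  have hosc : |φ (f.left.restr x) - φ (f.right.restr x)| ≤ 2 * ‖φ‖ := by
    rw [← Real.dist_eq]
    exact φ.dist_le_two_norm _ _
  refine add_le_add (add_le_add ?_ ?_) (mul_le_mul_of_nonneg_left hosc (abs_nonneg _))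
  · exact (mul_le_of_le_one_left (abs_nonneg _) hp1.le).trans (abs_sub_restr_le hφ _ _ x)
  · exact (mul_le_of_le_one_left (abs_nonneg _) (sub_le_self 1 hp.le)).trans
      (abs_sub_restr_le hφ _ _ x)

end RDS

/-! ### Limits of almost stationary measures -/

/-- Bounded Lipschitz functions separate probability measures. -/
theorem eq_of_forall_lipschitz_integral_eq {μ ν : ProbabilityMeasure OpenUnit}
    (heq : ∀ (φ : OpenUnit →ᵇ ℝ) (L : NNReal), LipschitzWith L φ →
      ∫ x, φ x ∂(μ : Measure OpenUnit) = ∫ x, φ x ∂(ν : Measure OpenUnit)) : μ = ν := by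
  -- The criterion for weak convergence is applied to a constant family.
  have h : Tendsto (fun _ : Unit => μ) (pure ()) (𝓝 ν) := by
    rw [tendsto_iff_forall_lipschitz_integral_tendsto]
    rintro φ hC ⟨L, hL⟩
    have e : ∫ x, φ x ∂(μ : Measure OpenUnit) = ∫ x, φ x ∂(ν : Measure OpenUnit) :=
      heq ⟨⟨φ, hL.continuous⟩, hC⟩ L hL
    rw [e]
    exact tendsto_const_nhds
  exact tendsto_nhds_unique tendsto_const_nhds h

namespace RDS

/-- A weak limit of measures which are asymptotically stationary for systems converging to `f` is
stationary for `f`. -/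
theorem isStationary_of_tendsto {ι : Type*} {l : Filter ι} [l.NeBot] {g : ι → RDS} {f : RDS}
    (hg : Tendsto g l (𝓝 f)) {μ : ι → ProbabilityMeasure OpenUnit}
    {ν : ProbabilityMeasure OpenUnit} (hμ : Tendsto μ l (𝓝 ν))
    (hstat : ∀ φ : OpenUnit →ᵇ ℝ, Tendsto
      (fun i => ∫ x, (g i).dual φ x ∂(μ i : Measure OpenUnit) -
        ∫ x, φ x ∂(μ i : Measure OpenUnit)) l (𝓝 0)) : f.IsStationary ν := by
  have hweak := ProbabilityMeasure.tendsto_iff_forall_integral_tendsto.1 hμ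
  have h : (⟨f.markov ν, inferInstance⟩ : ProbabilityMeasure OpenUnit) = ν := by
    refine eq_of_forall_lipschitz_integral_eq fun φ L hφ => ?_
    change ∫ x, φ x ∂(f.markov ν) = _
    rw [f.integral_markov]
    have hdiff : Tendsto (fun i => ∫ x, (g i).dual φ x ∂(μ i : Measure OpenUnit) -
        ∫ x, f.dual φ x ∂(μ i : Measure OpenUnit)) l (𝓝 0) := by
      refine squeeze_zero_norm (fun i => ?_) ((f.tendsto_norm_dual_sub hφ).comp hg)
      rw [← integral_sub (((g i).dual φ).integrable _) ((f.dual φ).integrable _)]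
      have := norm_integral_le_of_norm_le_const (μ := (μ i : Measure OpenUnit))
        (Eventually.of_forall fun x => ((g i).dual φ - f.dual φ).norm_coe_le_norm x)
      simpa using! this
    have hzero := ((hstat φ).sub hdiff).sub ((hweak (f.dual φ)).sub (hweak φ))
    have hc : Tendsto (fun _ : ι => (0 : ℝ)) l (𝓝 (0 - 0 -
        (∫ x, f.dual φ x ∂(ν : Measure OpenUnit) - ∫ x, φ x ∂(ν : Measure OpenUnit)))) := by
      refine hzero.congr fun i => ?_
      ring
    have := tendsto_nhds_unique hc tendsto_const_nhds
    linarith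
  exact congrArg (fun m : ProbabilityMeasure OpenUnit => (m : Measure OpenUnit)) h

/-! ### Existence of a stationary measure -/

/-- The Krylov–Bogolyubov construction: Cesàro means of the iterates of the Dirac mass at `1 / 2`
under the Markov operator stay in a fixed sublevel set of the Lyapunov integral. -/
theorem exists_isStationary_mem_closure (f : RDS) {α ρ C : ℝ} (hα : 0 < α) (hρ : 0 ≤ ρ)
    (hρ1 : ρ < 1) (hC : 0 ≤ C)
    (hf : ∀ x : OpenUnit, f.prob * lyap α (f.left.restr x) +
      (1 - f.prob) * lyap α (f.right.restr x) ≤ ρ * lyap α x + C) :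
    ∃ μ ∈ closure (lyapBall α ((C + 1) / (1 - ρ))), f.IsStationary μ := by
  set R : ℝ := (C + 1) / (1 - ρ) with hR
  have hρ' : 0 < 1 - ρ := sub_pos.2 hρ1
  have hR1 : 1 ≤ R := by rw [hR, le_div_iff₀ hρ']; linarith
  have hRle : ρ * R + C ≤ R := by
    have : R * (1 - ρ) = C + 1 := div_mul_cancel₀ _ hρ'.ne'
    linarith
  set c : OpenUnit := ⟨1 / 2, by norm_num, by norm_num⟩ with hc
  have hlc : lyap α c = 1 := by simp [lyap, hc, h]
  set m : ℕ → Measure OpenUnit := fun n => f.markov^[n] (Measure.dirac c) with hm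
  have hsucc : ∀ n, m (n + 1) = f.markov (m n) := fun n =>
    Function.iterate_succ_apply' f.markov n _
  have hprob : ∀ n, IsProbabilityMeasure (m n) := by
    intro n
    induction n with
    | zero => exact inferInstanceAs (IsProbabilityMeasure (Measure.dirac c))
    | succ n ih => rw [hsucc]; infer_instance
  have hint : ∀ n, ∫⁻ x, ENNReal.ofReal (lyap α x) ∂(m n) ≤ ENNReal.ofReal R := by
    intro n
    induction n with
    | zero =>
      change ∫⁻ x, ENNReal.ofReal (lyap α x) ∂(Measure.dirac c) ≤ _
      rw [lintegral_dirac, hlc]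
      exact ENNReal.ofReal_le_ofReal hR1
    | succ n ih =>
      rw [hsucc]
      have := hprob n
      refine (f.lintegral_markov_le hρ hC hf (m n)).trans ?_
      calc _ ≤ ENNReal.ofReal ρ * ENNReal.ofReal R + ENNReal.ofReal C := by gcongr
        _ = ENNReal.ofReal (ρ * R + C) := by
            rw [ENNReal.ofReal_add (by positivity) hC, ENNReal.ofReal_mul hρ]
        _ ≤ _ := ENNReal.ofReal_le_ofReal hRle
  set w : ℕ → ENNReal := fun n => ((n + 1 : ℕ) : ENNReal)⁻¹ with hw
  have hw1 : ∀ n, w n * ((n + 1 : ℕ) : ENNReal) = 1 := fun n =>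
    ENNReal.inv_mul_cancel (by simp) (by finiteness)
  set s : ℕ → Measure OpenUnit := fun n => w n • ∑ k ∈ Finset.range (n + 1), m k with hs
  have hsprob : ∀ n, IsProbabilityMeasure (s n) := by
    intro n
    refine ⟨?_⟩
    have := hprob
    rw [hs, Measure.smul_apply, Measure.finsetSum_apply]
    simpa using! hw1 n
  have hsmem : ∀ n, (⟨s n, hsprob n⟩ : ProbabilityMeasure OpenUnit) ∈ lyapBall α R := by
    intro n
    change ∫⁻ x, ENNReal.ofReal (lyap α x) ∂(s n) ≤ _
    rw [hs, lintegral_smul_measure, lintegral_finsetSum_measure, smul_eq_mul]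
    calc _ ≤ w n * ∑ k ∈ Finset.range (n + 1), ENNReal.ofReal R := by
          gcongr with k _
          exact hint k
      _ = _ := by
          rw [Finset.sum_const, Finset.card_range, nsmul_eq_mul, ← mul_assoc, hw1, one_mul]
  have hsint : ∀ n (φ : OpenUnit →ᵇ ℝ),
      ∫ x, φ x ∂(s n) = ((n : ℝ) + 1)⁻¹ * ∑ k ∈ Finset.range (n + 1), ∫ x, φ x ∂(m k) := by
    intro n φ
    have := hprob
    rw [hs, integral_smul_measure, integral_finsetSum_measure fun k _ => φ.integrable (m k)]
    rw [hw, ENNReal.toReal_inv, ENNReal.toReal_natCast, Nat.cast_succ, smul_eq_mul]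
  have hsdiff : ∀ φ : OpenUnit →ᵇ ℝ,
      Tendsto (fun n => ∫ x, f.dual φ x ∂(s n) - ∫ x, φ x ∂(s n)) atTop (𝓝 0) := by
    intro φ
    have hlim : Tendsto (fun n : ℕ => 1 / ((n : ℝ) + 1) * (2 * ‖φ‖)) atTop (𝓝 0) := by
      simpa using (tendsto_one_div_add_atTop_nhds_zero_nat (𝕜 := ℝ)).mul_const (2 * ‖φ‖)
    refine squeeze_zero_norm (fun n => ?_) hlim
    have e : ∀ k, ∫ x, f.dual φ x ∂(m k) = ∫ x, φ x ∂(m (k + 1)) := fun k => by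
      have := hprob k
      rw [hsucc, f.integral_markov]
    have b : ∀ k, ‖∫ x, φ x ∂(m k)‖ ≤ ‖φ‖ := fun k => by
      have := hprob k
      exact φ.norm_integral_le_norm (m k)
    -- The sum of the differences telescopes.
    rw [hsint, hsint, ← mul_sub, ← Finset.sum_sub_distrib]
    simp only [e]
    rw [Finset.sum_range_sub (fun k => ∫ x, φ x ∂(m k)), norm_mul, one_div,
      Real.norm_of_nonneg (by positivity)]
    refine mul_le_mul_of_nonneg_left ((norm_sub_le _ _).trans ?_) (by positivity)
    linarith [b (n + 1), b 0]
  obtain ⟨μ, hμ, hle⟩ := (isCompact_closure_lyapBall hα R).ultrafilter_le_nhds'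
    ((hyperfilter ℕ).map fun n => (⟨s n, hsprob n⟩ : ProbabilityMeasure OpenUnit))
    (Ultrafilter.mem_map.2 (Filter.univ_mem' fun n => subset_closure (hsmem n)))
  exact ⟨μ, hμ, isStationary_of_tendsto (l := (hyperfilter ℕ : Filter ℕ)) tendsto_const_nhds hle
    fun φ => (hsdiff φ).mono_left Nat.hyperfilter_le_atTop⟩

theorem exists_isStationary (f : RDS) : ∃ μ, f.IsStationary μ := by
  obtain ⟨α, hα, ρ, hρ, hρ1, C, hC, hf⟩ := f.exists_drift
  obtain ⟨μ, -, hμ⟩ := f.exists_isStationary_mem_closure hα hρ.le hρ1 hC hf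
  exact ⟨μ, hμ⟩

/-! ### Continuous dependence on the system -/

/-- By the uniform drift the stationary measures of the systems near `f` lie in one compact set,
and by uniqueness their only limit point at `f` is the stationary measure of `f`. -/
theorem continuous_of_isStationary {ψ : RDS → ProbabilityMeasure OpenUnit}
    (hψ : ∀ f : RDS, f.IsStationary (ψ f)) : Continuous ψ := by
  rw [continuous_iff_continuousAt]
  intro f
  obtain ⟨α, hα, ρ, hρ, hρ1, C, hC, hf⟩ := f.exists_eventually_drift
  have hmem : ∀ᶠ g in 𝓝 f, ψ g ∈ closure (lyapBall α ((C + 1) / (1 - ρ))) := by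
    filter_upwards [hf] with g hg
    obtain ⟨μ, hμ, hstat⟩ := g.exists_isStationary_mem_closure hα hρ.le hρ1 hC hg
    rwa [(hψ g).eq hstat]
  refine (tendsto_iff_ultrafilter _ _ _).2 fun U hU => ?_
  obtain ⟨ν, -, hν⟩ := (isCompact_closure_lyapBall hα _).ultrafilter_le_nhds' (U.map ψ)
    (Ultrafilter.mem_map.2 (hU hmem))
  have hstat : f.IsStationary ν := by
    refine isStationary_of_tendsto (l := (U : Filter RDS)) (g := id) hU hν fun φ => ?_
    refine tendsto_const_nhds.congr fun g => ?_
    have e := g.integral_markov φ (ψ g : Measure OpenUnit)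
    rw [show g.markov (ψ g : Measure OpenUnit) = ψ g from hψ g] at e
    rw [id, ← e, sub_self]
  rw [(hψ f).eq hstat]
  exact hν

end RDS

end RandomInterval

theorem mainTheorem5 :
    ∃ ψ : RandomInterval.RDS → MeasureTheory.ProbabilityMeasure RandomInterval.OpenUnit,
      (∀ f : RandomInterval.RDS, f.IsStationary (ψ f) ∧
        ∀ μ : MeasureTheory.ProbabilityMeasure RandomInterval.OpenUnit,
          f.IsStationary μ → μ = ψ f) ∧
      Continuous ψ := by
  choose ψ hψ using RandomInterval.RDS.exists_isStationary
  exact ⟨ψ, fun f => ⟨hψ f, fun μ hμ => hμ.eq (hψ f)⟩,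
    RandomInterval.RDS.continuous_of_isStationary hψ⟩
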